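/- Let $d\ge 1$ and $k\ge 1$ be integers. For a closed set $K\subset\mathbb R^d$ and an integer $m\ge 0$, let $C^m(K)$ be the set of restrictions to $K$ of functions of class $C^m$ on $\mathbb R^d$. A set is of class $C^k$ (resp. Lipschitz) if it is open and its boundary is locally the graph of a $C^k$ (resp. Lipschitz) function, with the set lying on one side of this graph. Let $\mathcal U\subset\mathbb R^d$ be a bounded domain of class $C^k$, let $\Omega\subset\mathbb R^d$ be a bounded Lipschitz domain with $\overline{\mathcal U}\subset\Omega$ (connectedness of $\mathcal U$ and $\Omega$ is not needed), and put $\omega=\Omega\setminus\overline{\mathcal U}$. Let $\psi\in C^{k+1}(\overline\omega)$ satisfy $\psi=0$ on $\partial\mathcal U$, $\psi>0$ in $\omega$ and $|\nabla\psi|\ge\lambda$ in $\omega$ for some constant $\lambda>0$. Let $n=\nabla\psi$ in $\omega$, extended continuously to $\overline\omega$, and suppose that $n\cdot\nu_\Omega>0$ at every point of $\partial\Omega$ at which the outward unit normal vector $\nu_\Omega$ to $\partial\Omega$ exists. Let $\beta,g\in C^k(\overline\omega)$ and $V\in C^k(\partial\mathcal U)$. Then there is exactly one function $W\in C^1(\overline\omega)$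 such that $$\nabla W\cdot n+\beta W=g\ \text{ in }\omega,\qquad W=V\ \text{ on }\partial\mathcal U,$$ and this function $W$ belongs to $C^k(\overline\omega)$. -/

import Mathlib

open Set Filter Topology

/-- `f` belongs to `C^m(K)`, for a closed set `K ⊆ ℝ^d`: `f` agrees on `K` with a `C^m` function
on the whole space. Only the values of `f` on `K` matter. -/
def IsOfClassOn {d : ℕ} (m : ℕ) (f : EuclideanSpace ℝ (Fin d) → ℝ)
    (K : Set (EuclideanSpace ℝ (Fin d))) : Prop :=
  ∃ F : EuclideanSpace ℝ (Fin d) → ℝ, ContDiff ℝ m F ∧ EqOn F f K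

/-- Near `x`, the set `D` is the part of space lying strictly below the graph of `h`, where heights
are measured along the unit vector `e` and `y - ⟪e, y⟫ e`, the orthogonal projection of `y`
to the hyperplane orthogonal to `e`, is the base point: only `h` on that hyperplane matters. -/
def IsLocallyBelowGraph {d : ℕ} (D : Set (EuclideanSpace ℝ (Fin d)))
    (x e : EuclideanSpace ℝ (Fin d)) (h : EuclideanSpace ℝ (Fin d) → ℝ) : Prop :=
  ‖e‖ = 1 ∧ ∀ᶠ y in 𝓝 x, (y ∈ D ↔ inner ℝ e y < h (y - inner ℝ e y • e))

/-- The open set `D` is of class `C^k`: its boundary is locally the graph of a `C^k` function,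
with `D` on one side of the graph. -/
def IsClassDomain {d : ℕ} (k : ℕ) (D : Set (EuclideanSpace ℝ (Fin d))) : Prop :=
  IsOpen D ∧ ∀ x ∈ frontier D, ∃ (e : EuclideanSpace ℝ (Fin d))
    (h : EuclideanSpace ℝ (Fin d) → ℝ), ContDiff ℝ k h ∧ IsLocallyBelowGraph D x e h

/-- The open set `D` has Lipschitz boundary: its boundary is locally the graph of a Lipschitz
function, with `D` on one side of the graph. -/
def IsLipschitzDomain {d : ℕ} (D : Set (EuclideanSpace ℝ (Fin d))) : Prop :=
  IsOpen D ∧ ∀ x ∈ frontier D, ∃ (e : EuclideanSpace ℝ (Fin d))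
    (h : EuclideanSpace ℝ (Fin d) → ℝ),
    (∃ L : NNReal, LipschitzWith L h) ∧ IsLocallyBelowGraph D x e h

/-- `ν` is the outward unit normal vector to `D` at the boundary point `x`: up to cones of
arbitrarily small opening around the hyperplane `x + νᗮ`, the set `D` coincides near `x` with the
half-space `⟪ν, y - x⟫ < 0`. When `D` lies locally below a Lipschitz graph, this holds (for exactly
one `ν`) exactly at the points over which the graph function is differentiable. -/
def IsOutwardUnitNormal {d : ℕ} (D : Set (EuclideanSpace ℝ (Fin d)))
    (x ν : EuclideanSpace ℝ (Fin d)) : Prop :=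
  x ∈ frontier D ∧ ‖ν‖ = 1 ∧ ∀ ε : ℝ, 0 < ε → ∀ᶠ y in 𝓝 x,
    (inner ℝ ν (y - x) < -(ε * ‖y - x‖) → y ∈ D) ∧
    (ε * ‖y - x‖ < inner ℝ ν (y - x) → y ∉ D)

/-- `W ∈ C^1(closure ω)` solves `∇W · n + β W = g` in `ω` and `W = V` on `Γ`. -/
def IsTransportSolution {d : ℕ} (ω Γ : Set (EuclideanSpace ℝ (Fin d)))
    (n : EuclideanSpace ℝ (Fin d) → EuclideanSpace ℝ (Fin d))
    (β g V W : EuclideanSpace ℝ (Fin d) → ℝ) : Prop :=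
  IsOfClassOn 1 W (closure ω) ∧
  (∀ x ∈ ω, inner ℝ (gradient W x) (n x) + β x * W x = g x) ∧
  ∀ x ∈ Γ, W x = V x

/-! The proof is the method of characteristics. On `closure ω` the field `X = n / |n|²` satisfies
`∇ψ · X = 1`. A curve run backwards along `X` from `x ∈ ω` therefore loses `ψ` at unit rate, and it
reaches `∂U` at time exactly `ψ x` unless it leaves through `∂Ω`. Prescribing the travel time `ψ x`
and rescaling it to `1` makes the arrival point and integrals along the curve values of a time-one
map at initial data depending on `x` in a `C^k` way.

Smoothness (`IsTimeOneMap.contDiff`): integral curves solve `γ - ∫ Z(γ) = const` in `C([0,1], E)`.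
For a field with Lipschitz constant below `1` the left side is a `C^k` homeomorphism with invertible
derivatives, so its inverse is `C^k`; halving time reduces the general case to this one.

No exit through `∂Ω` (`IsLipschitzDomain.notMem_frontier_of_curve`): the sign condition is known
only where a normal exists. Let `F` be the height above a local Lipschitz graph of `∂Ω`. Wherever
`F` is differentiable, its derivative along the backward field is at most `C |F|`; averaging over
small shifts turns this almost-everywhere bound into one for difference quotients, and an
exponential barrier keeps `F` negative.

The equation (`exists_contDiff_solution`): integration along characteristics solves `∇W · X = c`
with data on `∂U`. Applied to `β / |n|²` with zero data it gives an integrating exponent `A`;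
applied to `g e^A / |n|²` with data `V` it gives `Y`, and `W = Y e^{-A}`. For any other solution
`F`, `F e^A - Y` is constant along characteristics and vanishes at their ends, whence uniqueness. -/

/-! ### Superposition operators on spaces of continuous curves. -/

section Superposition

variable {I E F : Type*} [TopologicalSpace I] [CompactSpace I]
  [NormedAddCommGroup E] [NormedSpace ℝ E] [NormedAddCommGroup F] [NormedSpace ℝ F]

/-- A curve of linear maps acts pointwise on curves of vectors. -/
noncomputable def pointwiseApplyL (I E F : Type*) [TopologicalSpace I] [CompactSpace I]
    [NormedAddCommGroup E] [NormedSpace ℝ E] [NormedAddCommGroup F] [NormedSpace ℝ F] :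
    C(I, E →L[ℝ] F) →L[ℝ] C(I, E) →L[ℝ] C(I, F) :=
  LinearMap.mkContinuous₂
    (LinearMap.mk₂ ℝ (fun (A : C(I, E →L[ℝ] F)) (γ : C(I, E)) =>
        (⟨fun t => A t (γ t), by fun_prop⟩ : C(I, F)))
      (fun _ _ _ => by ext; simp) (fun _ _ _ => by ext; simp)
      (fun _ _ _ => by ext; simp) (fun _ _ _ => by ext; simp))
    1 (fun A γ => by
      rw [one_mul]
      refine (ContinuousMap.norm_le _ (mul_nonneg (norm_nonneg A) (norm_nonneg γ))).2 fun t => ?_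
      exact ((A t).le_opNorm _).trans (mul_le_mul (A.norm_coe_le_norm t) (γ.norm_coe_le_norm t)
        (norm_nonneg _) (norm_nonneg _)))

theorem norm_pointwiseApplyL_le (A : C(I, E →L[ℝ] F)) : ‖pointwiseApplyL I E F A‖ ≤ ‖A‖ := by
  refine ContinuousLinearMap.opNorm_le_bound _ (norm_nonneg A) fun γ => ?_
  refine (ContinuousMap.norm_le _ (mul_nonneg (norm_nonneg A) (norm_nonneg γ))).2 fun t => ?_
  exact ((A t).le_opNorm _).trans (mul_le_mul (A.norm_coe_le_norm t) (γ.norm_coe_le_norm t)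
    (norm_nonneg _) (norm_nonneg _))

/-- The superposition operator of a `C¹` map is differentiable. -/
theorem hasFDerivAt_superposition {f : E → F} (hf : ContDiff ℝ 1 f) (γ : C(I, E)) :
    HasFDerivAt (fun γ : C(I, E) => (ContinuousMap.mk f hf.continuous).comp γ)
      (pointwiseApplyL I E F
        ((ContinuousMap.mk (fderiv ℝ f) (hf.continuous_fderiv one_ne_zero)).comp γ)) γ := by
  rw [hasFDerivAt_iff_isLittleO_nhds_zero, Asymptotics.isLittleO_iff]
  intro ε hε
  obtain ⟨δ, hδ, H⟩ := (Metric.continuousAt_iff (a := γ) (f := fun γ : C(I, E) =>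
      (ContinuousMap.mk (fderiv ℝ f) (hf.continuous_fderiv one_ne_zero)).comp γ)).1
    (ContinuousMap.continuous_postcomp _).continuousAt ε hε
  filter_upwards [Metric.ball_mem_nhds (0 : C(I, E)) hδ] with η hη
  refine (ContinuousMap.norm_le _ (by positivity)).2 fun t => ?_
  have key : ∀ x ∈ Metric.ball (γ t) δ, ‖fderiv ℝ f x - fderiv ℝ f (γ t)‖ ≤ ε := by
    intro x hx
    -- Translating the whole curve by the constant `x - γ t` puts its value at `t` at `x`, so
    -- continuity of postcomposition at `γ` bounds the oscillation of `f'` with one `δ` for all `t`.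
    have h1 := @H (γ + ContinuousMap.const I (x - γ t)) (by
      rw [dist_eq_norm, add_sub_cancel_left, ContinuousMap.norm_lt_iff _ hδ]
      intro s
      simpa [dist_eq_norm] using hx)
    have h2 := (ContinuousMap.dist_apply_le_dist (f := (ContinuousMap.mk (fderiv ℝ f)
      (hf.continuous_fderiv one_ne_zero)).comp (γ + ContinuousMap.const I (x - γ t))) t).trans h1.le
    simpa [dist_eq_norm] using h2
  have hηt : ‖η t‖ < δ := (η.norm_coe_le_norm t).trans_lt (by simpa using hη)
  have h2 := (convex_ball (γ t) δ).norm_image_sub_le_of_norm_hasFDerivWithin_le'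
    (f := f) (f' := fderiv ℝ f) (φ := fderiv ℝ f (γ t)) (C := ε) (x := γ t) (y := γ t + η t)
    (fun x _ => ((hf.differentiable one_ne_zero) x).hasFDerivAt.hasFDerivWithinAt) key
    (Metric.mem_ball_self hδ) (by simpa [dist_eq_norm] using hηt)
  rw [add_sub_cancel_left] at h2
  exact h2.trans (by gcongr; exact η.norm_coe_le_norm t)

end Superposition

/-- The superposition operator of a `C^k` map is of class `C^k`. -/
theorem contDiff_superposition.{u} {I : Type*} [TopologicalSpace I] [CompactSpace I]
    {E : Type u} [NormedAddCommGroup E] [NormedSpace ℝ E] (k : ℕ) :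
    ∀ {F : Type u} [NormedAddCommGroup F] [NormedSpace ℝ F] {f : E → F} (_ : ContDiff ℝ k f)
      (hc : Continuous f), ContDiff ℝ k (fun γ : C(I, E) => (ContinuousMap.mk f hc).comp γ) := by
  -- `F` varies in the induction, and shares the universe of `E`, because the step applies the
  -- hypothesis to `fderiv ℝ f`, whose values lie in `E →L[ℝ] F`.
  induction k with
  | zero =>
    intro F _ _ f hf hc
    rw [Nat.cast_zero, contDiff_zero]
    exact ContinuousMap.continuous_postcomp _
  | succ k ih =>
    intro F _ _ f hf hc
    have h1 : ContDiff ℝ 1 f := hf.of_le (by norm_cast; omega)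
    have hf' : ContDiff ℝ k (fderiv ℝ f) :=
      hf.fderiv_right (by norm_cast)
    push_cast
    rw [contDiff_succ_iff_fderiv]
    refine ⟨fun γ => (hasFDerivAt_superposition h1 γ).differentiableAt, by simp, ?_⟩
    have : fderiv ℝ (fun γ : C(I, E) => (ContinuousMap.mk f hc).comp γ) =
        fun γ => pointwiseApplyL I E F ((ContinuousMap.mk (fderiv ℝ f) hf'.continuous).comp γ) :=
      funext fun γ => (hasFDerivAt_superposition h1 γ).fderiv
    rw [this]
    exact (pointwiseApplyL I E F).contDiff.comp (ih hf' _)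

/-! ### Differentiability of time-one maps of autonomous fields. -/

section TimeOneMap

variable {E : Type*} [NormedAddCommGroup E] [NormedSpace ℝ E]

/-- `γ` is an integral curve on `[0, 1]` of the autonomous field `Z`. -/
def IsUnitCurve (Z : E → E) (γ : ℝ → E) : Prop :=
  ∀ t ∈ Icc (0 : ℝ) 1, HasDerivAt γ (Z (γ t)) t

theorem IsUnitCurve.continuousOn {Z : E → E} {γ : ℝ → E} (h : IsUnitCurve Z γ) :
    ContinuousOn γ (Icc 0 1) := fun t ht => (h t ht).continuousAt.continuousWithinAt

theorem IsUnitCurve.eqOn {Z : E → E} {K : NNReal} (hZ : LipschitzWith K Z) {γ η : ℝ → E}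
    (hγ : IsUnitCurve Z γ) (hη : IsUnitCurve Z η) (h0 : γ 0 = η 0) : EqOn γ η (Icc 0 1) :=
  ODE_solution_unique (v := fun _ => Z) (fun _ => hZ) hγ.continuousOn
    (fun t ht => (hγ t (Ico_subset_Icc_self ht)).hasDerivWithinAt) hη.continuousOn
    (fun t ht => (hη t (Ico_subset_Icc_self ht)).hasDerivWithinAt) h0

theorem exists_isUnitCurve [CompleteSpace E] {Z : E → E} {K C : NNReal} (hZ : LipschitzWith K Z)
    (hC : ∀ x, ‖Z x‖ ≤ C) (x : E) : ∃ γ, γ 0 = x ∧ IsUnitCurve Z γ := by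
  -- The larger interval `[-1, 2]` yields two-sided derivatives at `0` and `1`; in time at most `2`
  -- a curve of speed at most `C` stays within `2 * C` of `x`.
  have hp : IsPicardLindelof (fun _ => Z) (tmin := -1) (tmax := 2) ⟨0, by norm_num, by norm_num⟩ x
      (2 * C) 0 C K :=
    { lipschitzOnWith := fun _ _ => hZ.lipschitzOnWith
      continuousOn := fun _ _ => continuousOn_const
      norm_le := fun _ _ y _ => hC y
      mul_max_le := by
        rw [max_eq_left (by norm_num)]
        push_cast
        linarith }
  obtain ⟨γ, h0, h1⟩ := hp.exists_eq_forall_mem_Icc_hasDerivWithinAt₀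
  refine ⟨γ, h0, fun t ht => (h1 t ⟨by linarith [ht.1], by linarith [ht.2]⟩).hasDerivAt
    (Icc_mem_nhds (by linarith [ht.1]) (by linarith [ht.2]))⟩

/-- Integration from `0` of curves on the unit interval. -/
noncomputable def unitPrimitiveL (E : Type*) [NormedAddCommGroup E] [NormedSpace ℝ E] :
    C(unitInterval, E) →L[ℝ] C(unitInterval, E) :=
  LinearMap.mkContinuous
    { toFun := fun η => ⟨fun t => ∫ s in (0 : ℝ)..t, IccExtend zero_le_one η s,
        (intervalIntegral.continuous_primitive
          (fun a b => (η.continuous.Icc_extend').intervalIntegrable a b) 0).comp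
            continuous_subtype_val⟩
      map_add' := fun η ξ => by
        ext t
        exact intervalIntegral.integral_add ((η.continuous.Icc_extend').intervalIntegrable _ _)
          ((ξ.continuous.Icc_extend').intervalIntegrable _ _)
      map_smul' := fun c η => by
        ext t
        exact intervalIntegral.integral_smul c _ }
    1 (fun η => by
      rw [one_mul]
      refine (ContinuousMap.norm_le _ (norm_nonneg _)).2 fun t => ?_
      have h := intervalIntegral.norm_integral_le_of_norm_le_const (a := 0) (b := (t : ℝ))
        (f := IccExtend zero_le_one η) (C := ‖η‖) (fun s _ => η.norm_coe_le_norm _)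
      refine h.trans ?_
      rw [sub_zero, abs_of_nonneg t.2.1]
      exact mul_le_of_le_one_right (norm_nonneg _) t.2.2)

theorem unitPrimitiveL_apply (η : C(unitInterval, E)) (t : unitInterval) :
    unitPrimitiveL E η t = ∫ s in (0 : ℝ)..t, IccExtend zero_le_one η s := rfl

theorem norm_unitPrimitiveL_le : ‖unitPrimitiveL E‖ ≤ 1 :=
  LinearMap.mkContinuous_norm_le _ zero_le_one _

/-- The operator whose value at an integral curve of `Z` is the constant curve at its initial
point. -/
noncomputable def initialOperator {Z : E → E} (hc : Continuous Z)
    (γ : C(unitInterval, E)) : C(unitInterval, E) :=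
  γ - unitPrimitiveL E ((ContinuousMap.mk Z hc).comp γ)

theorem initialOperator_of_isUnitCurve [CompleteSpace E] {Z : E → E} (hc : Continuous Z)
    {γ : ℝ → E} (h : IsUnitCurve Z γ) :
    initialOperator hc ⟨fun t => γ t, h.continuousOn.domRestrict⟩ =
      ContinuousMap.const unitInterval (γ 0) := by
  ext t
  have hsub : uIcc (0 : ℝ) t ⊆ Icc 0 1 := by
    rw [uIcc_of_le t.2.1]
    exact Icc_subset_Icc_right t.2.2
  have hint : ∫ s in (0 : ℝ)..t, Z (γ s) = γ t - γ 0 :=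
    intervalIntegral.integral_eq_sub_of_hasDerivAt (fun s hs => h s (hsub hs))
      ((hc.comp_continuousOn (h.continuousOn.mono hsub)).intervalIntegrable)
  simp only [initialOperator, ContinuousMap.sub_apply, ContinuousMap.const_apply,
    unitPrimitiveL_apply]
  rw [intervalIntegral.integral_congr (g := fun s => Z (γ s)), hint]
  · exact sub_sub_cancel _ _
  · intro s hs
    exact IccExtend_of_mem _ _ (hsub hs)

theorem contDiff_initialOperator.{u} {E : Type u} [NormedAddCommGroup E] [NormedSpace ℝ E]
    {k : ℕ} {Z : E → E} (hZ : ContDiff ℝ k Z) (hc : Continuous Z) :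
    ContDiff ℝ k (initialOperator hc) :=
  contDiff_id.sub ((unitPrimitiveL E).contDiff.comp (contDiff_superposition k hZ hc))

theorem norm_unitPrimitiveL_apply_le (η : C(unitInterval, E)) : ‖unitPrimitiveL E η‖ ≤ ‖η‖ :=
  ((unitPrimitiveL E).le_opNorm η).trans
    (mul_le_of_le_one_left (norm_nonneg _) norm_unitPrimitiveL_le)

/-- Integration has norm at most `1`, so the nonlinear part of the operator inherits the Lipschitz
constant of `Z`. For `c < 1` this makes the operator a global homeomorphism. -/
theorem approximatesLinearOn_initialOperator {Z : E → E} {c : NNReal} (hL : LipschitzWith c Z)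
    (hc : Continuous Z) :
    ApproximatesLinearOn (initialOperator hc)
      (ContinuousLinearEquiv.refl ℝ C(unitInterval, E) : C(unitInterval, E) →L[ℝ] _) univ c := by
  intro γ _ η _
  have : initialOperator hc γ - initialOperator hc η -
      (ContinuousLinearEquiv.refl ℝ C(unitInterval, E) : C(unitInterval, E) →L[ℝ] _) (γ - η) =
      unitPrimitiveL E ((ContinuousMap.mk Z hc).comp η - (ContinuousMap.mk Z hc).comp γ) := by
    rw [map_sub]
    simp only [initialOperator, ContinuousLinearEquiv.coe_coe, ContinuousLinearEquiv.coe_refl',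
      id]
    erw [map_sub]
    abel
  rw [this]
  refine (norm_unitPrimitiveL_apply_le _).trans ?_
  refine (ContinuousMap.norm_le _ (mul_nonneg c.2 (norm_nonneg (γ - η)))).2 fun t => ?_
  rw [norm_sub_rev γ]
  exact (hL.norm_sub_le _ _).trans
    (mul_le_mul_of_nonneg_left ((η - γ).norm_coe_le_norm t) c.2)

/-- The derivative is the identity minus an operator of norm at most `c < 1`, invertible by the
Neumann series. -/
theorem exists_hasFDerivAt_initialOperator [CompleteSpace E] {Z : E → E} {c : NNReal}
    (hZ : ContDiff ℝ 1 Z) (hL : LipschitzWith c Z) (h1 : c < 1) (hc : Continuous Z)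
    (γ : C(unitInterval, E)) :
    ∃ A : C(unitInterval, E) ≃L[ℝ] C(unitInterval, E),
      HasFDerivAt (initialOperator hc) (A : C(unitInterval, E) →L[ℝ] _) γ := by
  set Λ := pointwiseApplyL unitInterval E E
    ((ContinuousMap.mk (fderiv ℝ Z) (hZ.continuous_fderiv one_ne_zero)).comp γ) with hΛ
  have hΛn : ‖Λ‖ ≤ c := (norm_pointwiseApplyL_le _).trans
    ((ContinuousMap.norm_le _ c.2).2 fun t => norm_fderiv_le_of_lipschitz ℝ hL)
  have hn : ‖(unitPrimitiveL E).comp Λ‖ < 1 := by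
    refine ((unitPrimitiveL E).opNorm_comp_le Λ).trans_lt ?_
    calc _ ≤ 1 * (c : ℝ) := by
            gcongr
            exact norm_unitPrimitiveL_le
      _ < 1 := by simpa using h1
  refine ⟨ContinuousLinearEquiv.unitsEquiv ℝ _
    (Units.oneSub ((unitPrimitiveL E).comp Λ) hn), ?_⟩
  exact (hasFDerivAt_id γ).sub
    ((unitPrimitiveL E).hasFDerivAt.comp γ (hasFDerivAt_superposition hZ γ))

/-- `Φ` is the time-one map of the autonomous field `Z`. -/
def IsTimeOneMap (Z Φ : E → E) : Prop := ∀ x, ∃ γ, γ 0 = x ∧ γ 1 = Φ x ∧ IsUnitCurve Z γ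

/-- The map `Φ` is a composition: `x` goes to its constant curve, then through the inverse of
`initialOperator` to the integral curve, then to the value at `1`. The outer two maps are continuous
linear. -/
theorem IsTimeOneMap.contDiff_of_lipschitzWith_lt_one.{u} {E : Type u} [NormedAddCommGroup E]
    [NormedSpace ℝ E] [CompleteSpace E] {k : ℕ} (hk : 1 ≤ k) {Z Φ : E → E} {c : NNReal}
    (hZ : ContDiff ℝ k Z) (hL : LipschitzWith c Z) (h1 : c < 1) (hΦ : IsTimeOneMap Z Φ) :
    ContDiff ℝ k Φ := by
  have hc := hZ.continuous
  have hN : Subsingleton C(unitInterval, E) ∨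
      c < ‖((ContinuousLinearEquiv.refl ℝ C(unitInterval, E)).symm :
        C(unitInterval, E) →L[ℝ] C(unitInterval, E))‖₊⁻¹ := by
    rcases subsingleton_or_nontrivial C(unitInterval, E) with h | h
    · exact Or.inl h
    · right
      have : ‖((ContinuousLinearEquiv.refl ℝ C(unitInterval, E)).symm :
        C(unitInterval, E) →L[ℝ] C(unitInterval, E))‖₊ = 1 := by
        ext
        exact ContinuousLinearMap.norm_id
      rwa [this, inv_one]
  set G := (approximatesLinearOn_initialOperator hL hc).toHomeomorph _ hN with hG
  choose A hA using
    exists_hasFDerivAt_initialOperator (hZ.of_le (by exact_mod_cast hk)) hL h1 hc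
  have hsymm : ContDiff ℝ k G.symm :=
    G.contDiff_symm hA (contDiff_initialOperator hZ hc)
  have hcomp : Φ = fun x => ContinuousMap.evalCLM ℝ (1 : unitInterval)
      (G.symm (ContinuousLinearMap.const ℝ unitInterval x)) := by
    funext x
    obtain ⟨γ, h0, h1, hγ⟩ := hΦ x
    have h2 : G ⟨fun t => γ t, hγ.continuousOn.domRestrict⟩ = ContinuousMap.const unitInterval x := by
      rw [← h0]
      exact initialOperator_of_isUnitCurve hc hγ
    have h3 : G.symm (ContinuousLinearMap.const ℝ unitInterval x) =
        ⟨fun t => γ t, hγ.continuousOn.domRestrict⟩ := G.symm_apply_eq.2 h2.symm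
    simp only [h3, ← h1]
    rfl
  rw [hcomp]
  exact (ContinuousMap.evalCLM ℝ (1 : unitInterval)).contDiff.comp
    (hsymm.comp (ContinuousLinearMap.const ℝ unitInterval).contDiff)

theorem IsUnitCurve.firstHalf {Z : E → E} {γ : ℝ → E} (h : IsUnitCurve Z γ) :
    IsUnitCurve (fun x => (2⁻¹ : ℝ) • Z x) (fun t => γ (2⁻¹ * t)) := fun t ht =>
  (h (2⁻¹ * t) ⟨by linarith [ht.1], by linarith [ht.2]⟩).scomp t
    (by simpa using (hasDerivAt_id t).const_mul (2⁻¹ : ℝ))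

theorem IsUnitCurve.secondHalf {Z : E → E} {γ : ℝ → E} (h : IsUnitCurve Z γ) :
    IsUnitCurve (fun x => (2⁻¹ : ℝ) • Z x) (fun t => γ (2⁻¹ + 2⁻¹ * t)) := fun t ht =>
  (h (2⁻¹ + 2⁻¹ * t) ⟨by linarith [ht.1], by linarith [ht.2]⟩).scomp t
    (by simpa using ((hasDerivAt_id t).const_mul (2⁻¹ : ℝ)).const_add 2⁻¹)

/-- The time-one map of a Lipschitz field of class `C^k` is of class `C^k`. -/
theorem IsTimeOneMap.contDiff.{u} {E : Type u} [NormedAddCommGroup E]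
    [NormedSpace ℝ E] [CompleteSpace E] {k : ℕ} (hk : 1 ≤ k) {Z Φ : E → E} {K : NNReal}
    (hZ : ContDiff ℝ k Z) (hL : LipschitzWith K Z) (hΦ : IsTimeOneMap Z Φ) :
    ContDiff ℝ k Φ := by
  -- After `m` halvings of the field the Lipschitz constant is below `1`; each halving is undone by
  -- composing the time-one map with itself.
  obtain ⟨m, hm⟩ := pow_unbounded_of_one_lt K one_lt_two
  induction m generalizing Z Φ K with
  | zero => exact hΦ.contDiff_of_lipschitzWith_lt_one hk hZ hL (by simpa using hm)
  | succ m ih =>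
    have hL2 : LipschitzWith (2⁻¹ * K) fun x => (2⁻¹ : ℝ) • Z x := by
      refine LipschitzWith.of_dist_le_mul fun x y => ?_
      rw [dist_smul₀]
      have := hL.dist_le_mul x y
      simp only [norm_inv, Real.norm_ofNat, NNReal.coe_mul, NNReal.coe_inv, NNReal.coe_ofNat]
      linarith
    choose γ h0 h1 hγ using hΦ
    have hh : ContDiff ℝ k fun x => γ x 2⁻¹ :=
      ih (hZ.const_smul _) hL2 (fun x => ⟨_, by simp [h0], by simp, (hγ x).firstHalf⟩)
        (by rw [pow_succ] at hm
            rw [inv_mul_lt_iff₀ two_pos, mul_comm]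
            exact hm)
    have : Φ = (fun x => γ x 2⁻¹) ∘ fun x => γ x 2⁻¹ := by
      funext x
      have := IsUnitCurve.eqOn hL2 (hγ (γ x 2⁻¹)).firstHalf (hγ x).secondHalf (by simp [h0])
        (right_mem_Icc.2 zero_le_one)
      simp only [mul_one] at this
      rw [Function.comp_apply, this, ← h1]
      norm_num
    rw [this]
    exact hh.comp hh

end TimeOneMap

/-! ### Lipschitz functions with almost-everywhere derivative bounds. -/

section Averaging

open MeasureTheory

variable {E : Type*} [NormedAddCommGroup E] [NormedSpace ℝ E] [FiniteDimensional ℝ E]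

theorem LipschitzWith.ae_differentiableAt_add [MeasurableSpace E] [BorelSpace E]
    {μ : Measure E} [μ.IsAddHaarMeasure] {F : E → ℝ} {L : NNReal} (hF : LipschitzWith L F) (z : E) :
    ∀ᵐ t ∂μ, DifferentiableAt ℝ F (z + t) := by
  have h : LipschitzWith L fun t => F (z + t) :=
    LipschitzWith.of_dist_le_mul fun x y => by simpa using hF.dist_le_mul (z + x) (z + y)
  filter_upwards [h.ae_differentiableAt (μ := μ)] with t ht
  rw [← neg_add_cancel_left z t] at ht
  have := ht.comp (z + t) (f := fun w => -z + w) (differentiableAt_id.const_add _)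
  have h2 : (fun t => F (z + t)) ∘ (fun w => -z + w) = F := by
    funext w
    simp
  rwa [h2] at this

/-- A bound of the directional derivative of a Lipschitz function, at the points of a ball at which
it exists, bounds the difference quotients in this ball. -/
theorem LipschitzWith.sub_le_mul_of_fderiv_le {F : E → ℝ} {L : NNReal}
    (hF : LipschitzWith L F) {p x v : E} {r c s : ℝ} (hs : 0 ≤ s)
    (hx : x ∈ Metric.ball p r) (hxs : x + s • v ∈ Metric.ball p r)
    (hc : ∀ y ∈ Metric.ball p r, DifferentiableAt ℝ F y → fderiv ℝ F y v ≤ c) :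
    F (x + s • v) - F x ≤ c * s := by
  borelize E
  let μ : Measure E := Measure.addHaar
  have hsegment : ∀ σ ∈ Icc 0 s, dist (x + σ • v) p ≤ max (dist x p) (dist (x + s • v) p) := by
    intro σ hσ
    have hconv := (convexOn_dist p (convex_univ (𝕜 := ℝ) (E := E)))
    rcases hs.eq_or_lt with h0 | h0
    · have : σ = 0 := le_antisymm (hσ.2.trans h0.symm.le) hσ.1
      simp [this]
    · have h1 : x + σ • v = (1 - σ / s) • x + (σ / s) • (x + s • v) := by
        rw [smul_add, smul_smul, div_mul_cancel₀ _ h0.ne', sub_smul, one_smul]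
        abel
      rw [h1]
      exact hconv.le_max_of_mem_segment (mem_univ x) (mem_univ (x + s • v))
        ⟨1 - σ / s, σ / s, sub_nonneg.2 ((div_le_one h0).2 hσ.2), div_nonneg hσ.1 hs, by ring, rfl⟩
  set ρ := r - max (dist x p) (dist (x + s • v) p) with hρ
  have hρ0 : 0 < ρ := sub_pos.2 (max_lt hx hxs)
  -- The segment may contain no point of differentiability, so `F` is averaged over shifts in a
  -- `δ`-ball. By Rademacher's theorem the derivative bound holds for almost every shift, hence for
  -- the averages; replacing `F` by its average costs at most `L * δ` at each end. The margin `ρ`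
  -- keeps the shifted segments in the ball.
  suffices H : ∀ δ > 0, δ < ρ → F (x + s • v) - F x ≤ c * s + 2 * (L * δ) by
    have hlim : Tendsto (fun δ : ℝ => c * s + 2 * (L * δ)) (𝓝[>] 0) (𝓝 (c * s + 2 * (L * 0))) :=
      (Continuous.tendsto (by fun_prop) 0).mono_left nhdsWithin_le_nhds
    rw [mul_zero, mul_zero, add_zero] at hlim
    refine ge_of_tendsto hlim ?_
    filter_upwards [Ioo_mem_nhdsGT hρ0] with δ hδ using H δ hδ.1 hδ.2
  intro δ hδ hδρ
  set B := Metric.ball (0 : E) δ with hB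
  have hfin : μ B < ⊤ := measure_ball_lt_top
  have : IsFiniteMeasure (μ.restrict B) := ⟨by simpa using hfin⟩
  have hvol : 0 < μ.real B := ENNReal.toReal_pos (Metric.measure_ball_pos μ 0 hδ).ne' hfin.ne
  have hint : ∀ z : E, IntegrableOn (fun t => F (z + t)) B μ := fun z =>
    ((hF.continuous.comp (continuous_const.add continuous_id)).continuousOn.integrableOn_compact
      (isCompact_closedBall (0 : E) δ)).mono_set Metric.ball_subset_closedBall
  have hderiv : ∀ σ : ℝ, IntegrableOn (fun t => fderiv ℝ F (x + σ • v + t) v) B μ ∧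
      HasDerivAt (fun σ => ∫ t in B, F (x + σ • v + t) ∂μ)
        (∫ t in B, fderiv ℝ F (x + σ • v + t) v ∂μ) σ := by
    intro σ
    refine hasDerivAt_integral_of_dominated_loc_of_lip (bound := fun _ => (L : ℝ) * ‖v‖)
      (s := univ) univ_mem
      (Eventually.of_forall fun σ => (hint _).aestronglyMeasurable) (hint _)
      (((measurable_fderiv_apply_const ℝ F v).comp
        (measurable_const_add _)).aestronglyMeasurable) ?_ (integrable_const _) ?_
    · refine Eventually.of_forall fun t => LipschitzOnWith.of_dist_le_mul fun a _ b _ => ?_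
      refine (hF.dist_le_mul _ _).trans (le_of_eq ?_)
      rw [dist_add_right, dist_add_left, dist_eq_norm, ← sub_smul, norm_smul, dist_eq_norm]
      simp only [Real.coe_nnabs, abs_mul, NNReal.abs_eq, abs_norm]
      ring
    · filter_upwards [ae_restrict_of_ae (hF.ae_differentiableAt_add (μ := μ) (x + σ • v))] with t ht
      have h1 : HasDerivAt (fun σ : ℝ => x + σ • v + t) v σ := by
        simpa using (((hasDerivAt_id σ).smul_const v).const_add x).add_const t
      exact ht.hasFDerivAt.comp_hasDerivAt σ h1
  have hle : ∀ σ ∈ Icc 0 s, ∫ t in B, fderiv ℝ F (x + σ • v + t) v ∂μ ≤ c * μ.real B := by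
    intro σ hσ
    have : ∫ _ in B, c ∂μ = c * μ.real B := by
      rw [setIntegral_const, smul_eq_mul, mul_comm]
    rw [← this]
    refine setIntegral_mono_ae_restrict (hderiv σ).1 (integrable_const _) ?_
    filter_upwards [ae_restrict_of_ae (hF.ae_differentiableAt_add (μ := μ) (x + σ • v)),
      ae_restrict_mem Metric.isOpen_ball.measurableSet] with t ht htB
    refine hc _ ?_ ht
    have h1 := hsegment σ hσ
    have h2 : dist (x + σ • v + t) (x + σ • v) < δ := by simpa [dist_eq_norm, hB] using htB
    have h3 := dist_triangle (x + σ • v + t) (x + σ • v) p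
    rw [Metric.mem_ball]
    linarith
  have hmv := (convex_Icc 0 s).image_sub_le_mul_sub_of_deriv_le
    (f := fun σ => ∫ t in B, F (x + σ • v + t) ∂μ)
    (fun σ _ => (hderiv σ).2.continuousAt.continuousWithinAt)
    (fun σ _ => (hderiv σ).2.differentiableAt.differentiableWithinAt)
    (C := c * μ.real B)
    (fun σ hσ => (hderiv σ).2.deriv.trans_le (hle σ (interior_subset hσ)))
    0 (left_mem_Icc.2 hs) s (right_mem_Icc.2 hs) hs
  have happrox : ∀ z, |∫ t in B, F (z + t) ∂μ - F z * μ.real B| ≤ L * δ * μ.real B := by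
    intro z
    have h1 : ∫ t in B, F (z + t) ∂μ - F z * μ.real B = ∫ t in B, (F (z + t) - F z) ∂μ := by
      rw [integral_sub (hint z) (integrable_const _), setIntegral_const, smul_eq_mul, mul_comm]
    rw [h1, ← Real.norm_eq_abs]
    refine norm_setIntegral_le_of_norm_le_const hfin fun t ht => ?_
    rw [← dist_eq_norm]
    refine (hF.dist_le_mul _ _).trans ?_
    gcongr
    simpa [dist_eq_norm] using (Metric.mem_ball.1 ht).le
  have h1 := abs_le.1 (happrox (x + s • v))
  have h2 := abs_le.1 (happrox x)
  simp only [zero_smul, add_zero, sub_zero] at hmv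
  refine le_of_mul_le_mul_right ?_ hvol
  nlinarith [h1.1, h2.2]

/-- Along a curve of velocity `X`, a Lipschitz function `F` whose derivative in the direction `X`
is at most `C |F|` wherever it exists remains negative. -/
theorem LipschitzWith.neg_along_curve {F : E → ℝ} {L : NNReal} (hF : LipschitzWith L F)
    {X : E → E} (hX : Continuous X) {D : Set E} (hD : IsOpen D) {C : ℝ}
    (hdF : ∀ y ∈ D, DifferentiableAt ℝ F y → fderiv ℝ F y (X y) ≤ C * |F y|)
    {γ : ℝ → E} {a b : ℝ} (hab : a ≤ b) (hγ : ∀ t ∈ Icc a b, HasDerivAt γ (X (γ t)) t)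
    (hγD : ∀ t ∈ Icc a b, γ t ∈ D) (ha : F (γ a) < 0) : F (γ b) < 0 := by
  -- Since `B < 0`, `B' = (C + 1) |B|` strictly exceeds the slope bound `C |F|` wherever `F ∘ γ`
  -- meets the barrier.
  set B : ℝ → ℝ := fun t => F (γ a) * Real.exp (-(C + 1) * (t - a)) with hB
  have hBneg : ∀ t, B t < 0 := fun t => mul_neg_of_neg_of_pos ha (Real.exp_pos _)
  have hBd : ∀ t, HasDerivAt B (-(C + 1) * B t) t := by
    intro t
    have h1 : HasDerivAt (fun t : ℝ => -(C + 1) * (t - a)) (-(C + 1)) t := by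
      simpa using ((hasDerivAt_id t).sub_const a).const_mul (-(C + 1))
    exact (h1.exp.const_mul (F (γ a))).congr_deriv (by ring)
  refine (image_le_of_liminf_slope_right_lt_deriv_boundary (f := F ∘ γ) (B := B)
    (f' := fun t => C * |F (γ t)|)
    (fun t ht => (hF.continuous.continuousAt.comp (hγ t ht).continuousAt).continuousWithinAt)
    ?_ (by simp [hB]) hBd ?_ (right_mem_Icc.2 hab)).trans_lt (hBneg b)
  · intro t ht R hR
    have htI := Ico_subset_Icc_self ht
    refine Eventually.frequently ?_
    set v := X (γ t) with hv
    -- One `ε` pays for the variation of `X` and `|F|` near `γ t`, the other for replacing the curve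
    -- by its tangent line.
    set ε := (R - C * |F (γ t)|) / 2 with hε
    have hε0 : 0 < ε := half_pos (sub_pos.2 hR)
    have hcont : Continuous fun w => C * |F w| + L * ‖v - X w‖ := by
      have := hF.continuous
      fun_prop
    have hnear : ∀ᶠ w in 𝓝 (γ t), w ∈ D ∧ C * |F w| + L * ‖v - X w‖ < C * |F (γ t)| + ε :=
      (hD.eventually_mem (hγD t htI)).and
        (hcont.continuousAt.eventually_lt continuousAt_const (by simp [hv, hε0]))
    obtain ⟨ρ, hρ, hball⟩ := Metric.eventually_nhds_iff_ball.1 hnear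
    have hfd : ∀ w ∈ Metric.ball (γ t) ρ, DifferentiableAt ℝ F w →
        fderiv ℝ F w v ≤ C * |F (γ t)| + ε := by
      intro w hw hdiff
      obtain ⟨hwD, hlt⟩ := hball w hw
      have h1 : fderiv ℝ F w (v - X w) ≤ L * ‖v - X w‖ :=
        (le_abs_self _).trans (((fderiv ℝ F w).le_opNorm _).trans
          (mul_le_mul_of_nonneg_right (norm_fderiv_le_of_lipschitz ℝ hF) (norm_nonneg _)))
      have h2 := hdF w hwD hdiff
      rw [map_sub] at h1
      linarith
    have hmem : ∀ᶠ z in 𝓝[>] t, γ t + (z - t) • v ∈ Metric.ball (γ t) ρ := by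
      have : ContinuousAt (fun z : ℝ => γ t + (z - t) • v) t := by fun_prop
      refine (this.eventually_mem ?_).filter_mono nhdsWithin_le_nhds
      simpa using Metric.ball_mem_nhds _ hρ
    have hlittle := (hasDerivAt_iff_isLittleO.1 (hγ t htI)).def
      (c := ε / (2 * (L + 1))) (by positivity)
    filter_upwards [hmem, hlittle.filter_mono nhdsWithin_le_nhds, self_mem_nhdsWithin]
      with z hz1 hz2 hz3
    have hzt : 0 < z - t := sub_pos.2 hz3
    have h1 := hF.sub_le_mul_of_fderiv_le hzt.le (Metric.mem_ball_self hρ) hz1 hfd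
    have h2 : F (γ z) - F (γ t + (z - t) • v) ≤ L * (ε / (2 * (L + 1)) * (z - t)) := by
      refine (le_abs_self _).trans ((hF.dist_le_mul _ _).trans ?_)
      gcongr
      rw [Real.norm_of_nonneg hzt.le] at hz2
      rw [dist_eq_norm, ← sub_sub]
      exact hz2
    have h3 : (L : ℝ) * (ε / (2 * (L + 1)) * (z - t)) < ε * (z - t) := by
      rw [← mul_assoc]
      refine mul_lt_mul_of_pos_right ?_ hzt
      rw [mul_div_assoc', div_lt_iff₀ (by positivity)]
      nlinarith [L.2, NNReal.coe_nonneg L]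
    rw [slope_def_field, div_lt_iff₀ hzt]
    simp only [Function.comp_apply]
    have : R = C * |F (γ t)| + 2 * ε := by rw [hε]; ring
    rw [this]
    nlinarith
  · intro t _ heq
    have h1 : F (γ t) = B t := heq
    simp only [h1]
    rw [abs_of_neg (hBneg t)]
    nlinarith [hBneg t]

end Averaging

/-! ### Domains below graphs, their normals, and the boundary barrier. -/

section GraphDomains

variable {d : ℕ}

local notation "𝔼" => EuclideanSpace ℝ (Fin d)

/-- The height of a point above the graph of `h`, measured along `e`. -/
noncomputable def graphHeight (e : EuclideanSpace ℝ (Fin d)) (h : EuclideanSpace ℝ (Fin d) → ℝ)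
    (y : EuclideanSpace ℝ (Fin d)) : ℝ :=
  inner ℝ e y - h (y - inner ℝ e y • e)

/-- Translation along `e` does not move the base point. Hence the height has slope one along `e`,
and its differentiability at a point passes to the whole vertical line, in particular to the point
of the graph. -/
theorem graphHeight_add_smul {e : 𝔼} (he : ‖e‖ = 1) (h : 𝔼 → ℝ) (y : 𝔼) (t : ℝ) :
    graphHeight e h (y + t • e) = graphHeight e h y + t := by
  have h1 : inner ℝ e (y + t • e) = inner ℝ e y + t := by
    rw [inner_add_right, inner_smul_right, real_inner_self_eq_norm_sq, he]
    ring
  have h2 : y + t • e - (inner ℝ e y + t) • e = y - inner ℝ e y • e := by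
    rw [add_smul]
    abel
  rw [graphHeight, h1, h2, graphHeight]
  ring

theorem continuous_graphHeight (e : 𝔼) {h : 𝔼 → ℝ} (hh : Continuous h) :
    Continuous (graphHeight e h) := by
  unfold graphHeight
  fun_prop

theorem exists_lipschitzWith_graphHeight (e : 𝔼) {h : 𝔼 → ℝ} {L : NNReal}
    (hh : LipschitzWith L h) : ∃ L', LipschitzWith L' (graphHeight e h) := by
  have h1 := (innerSL ℝ e).lipschitz
  exact ⟨_, h1.sub (hh.comp (LipschitzWith.id.sub
    (((ContinuousLinearMap.id ℝ ℝ).smulRight e).lipschitz.comp h1)))⟩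

theorem isLocallyBelowGraph_iff {D : Set 𝔼} {x e : 𝔼} {h : 𝔼 → ℝ} :
    IsLocallyBelowGraph D x e h ↔ ‖e‖ = 1 ∧ ∀ᶠ y in 𝓝 x, (y ∈ D ↔ graphHeight e h y < 0) := by
  simp only [IsLocallyBelowGraph, graphHeight, sub_neg]

/-- Near a boundary point, the boundary of a set below a continuous graph is the graph. -/
theorem mem_frontier_iff_graphHeight_eq_zero {D : Set 𝔼} (hD : IsOpen D) {x e : 𝔼} {h : 𝔼 → ℝ}
    (hh : Continuous h) (hg : IsLocallyBelowGraph D x e h) :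
    x ∈ frontier D ↔ graphHeight e h x = 0 := by
  obtain ⟨he, hev⟩ := isLocallyBelowGraph_iff.1 hg
  have hc := continuous_graphHeight e hh
  have hx := hev.self_of_nhds
  rw [hD.frontier_eq, Set.mem_sdiff]
  constructor
  · rintro ⟨h1, h2⟩
    refine le_antisymm ?_ (not_lt.1 (mt hx.2 h2))
    by_contra! hlt
    obtain ⟨y, ⟨hy1, hy2⟩, hyD⟩ := (mem_closure_iff_frequently.1 h1).and_eventually
      (hev.and (hc.continuousAt.eventually_const_lt hlt)) |>.exists.imp fun y hy =>
        (⟨hy.2, hy.1⟩ : ((y ∈ D ↔ graphHeight e h y < 0) ∧ 0 < graphHeight e h y) ∧ y ∈ D)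
    exact lt_asymm hy2 (hy1.1 hyD)
  · intro h0
    refine ⟨?_, fun h2 => (hx.1 h2).ne h0⟩
    have hlim : Tendsto (fun t : ℝ => x + t • e) (𝓝[<] 0) (𝓝 x) := by
      have : Tendsto (fun t : ℝ => x + t • e) (𝓝 0) (𝓝 (x + (0 : ℝ) • e)) :=
        Continuous.tendsto (by fun_prop) 0
      rw [zero_smul, add_zero] at this
      exact this.mono_left nhdsWithin_le_nhds
    refine mem_closure_of_tendsto hlim ?_
    filter_upwards [hlim.eventually hev, self_mem_nhdsWithin] with t ht ht0
    rw [ht, graphHeight_add_smul he, h0, zero_add]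
    exact ht0

/-- A boundary point of a set below a continuous graph is a limit of exterior points. -/
theorem mem_closure_compl_closure_of_isLocallyBelowGraph {D : Set 𝔼} (hD : IsOpen D) {x e : 𝔼}
    {h : 𝔼 → ℝ} (hh : Continuous h) (hg : IsLocallyBelowGraph D x e h) (hx : x ∈ frontier D) :
    x ∈ closure (closure D)ᶜ := by
  have h0 := (mem_frontier_iff_graphHeight_eq_zero hD hh hg).1 hx
  obtain ⟨he, hev⟩ := isLocallyBelowGraph_iff.1 hg
  have hc := continuous_graphHeight e hh
  have hlim : Tendsto (fun t : ℝ => x + t • e) (𝓝[>] 0) (𝓝 x) := by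
    have : Tendsto (fun t : ℝ => x + t • e) (𝓝 0) (𝓝 (x + (0 : ℝ) • e)) :=
      Continuous.tendsto (by fun_prop) 0
    rw [zero_smul, add_zero] at this
    exact this.mono_left nhdsWithin_le_nhds
  refine mem_closure_of_tendsto hlim ?_
  filter_upwards [hlim.eventually hev.eventually_nhds, self_mem_nhdsWithin] with t ht ht0 hcl
  have hpos : 0 < graphHeight e h (x + t • e) := by
    rw [graphHeight_add_smul he, h0, zero_add]
    exact ht0
  obtain ⟨y, hyD, hy1, hy2⟩ := ((mem_closure_iff_frequently.1 hcl).and_eventually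
    (ht.and (hc.continuousAt.eventually_const_lt hpos))).exists
  exact lt_asymm hy2 (hy1.1 hyD)

/-- At a point at which it is differentiable with nonzero gradient `v`, a local defining function
gives the outward unit normal. -/
theorem isOutwardUnitNormal_of_hasGradientAt {D : Set 𝔼} {F : 𝔼 → ℝ} {x v : 𝔼}
    (hx : x ∈ frontier D) (hF0 : F x = 0) (hF : HasGradientAt F v x) (hv : v ≠ 0)
    (hD : ∀ᶠ y in 𝓝 x, (y ∈ D ↔ F y < 0)) : IsOutwardUnitNormal D x (‖v‖⁻¹ • v) := by
  have hv0 : 0 < ‖v‖ := norm_pos_iff.2 hv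
  refine ⟨hx, ?_, fun ε hε => ?_⟩
  · rw [norm_smul, norm_inv, norm_norm, inv_mul_cancel₀ hv0.ne']
  have hlittle := (hasGradientAt_iff_isLittleO.1 hF).def (c := ε * ‖v‖) (by positivity)
  filter_upwards [hD, hlittle] with y hy1 hy2
  rw [hF0, sub_zero, Real.norm_eq_abs, abs_le] at hy2
  rw [hy1, inner_smul_left, RCLike.conj_to_real, not_lt, inv_mul_lt_iff₀ hv0,
    lt_inv_mul_iff₀ hv0]
  constructor
  · intro h
    nlinarith [hy2.2]
  · intro h
    nlinarith [hy2.1]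

/-- A curve whose velocity `X` nowhere points outward at the boundary points of a Lipschitz domain
that have a normal does not reach the boundary from inside. -/
theorem IsLipschitzDomain.notMem_frontier_of_curve {Ω : Set 𝔼} (hΩ : IsLipschitzDomain Ω)
    {X : 𝔼 → 𝔼} {M : NNReal} (hX : LipschitzWith M X)
    (hout : ∀ x ∈ frontier Ω, ∀ ν, IsOutwardUnitNormal Ω x ν → inner ℝ (X x) ν ≤ 0)
    {γ : ℝ → 𝔼} {a b : ℝ} (hab : a < b) (hγ : ∀ t ∈ Icc a b, HasDerivAt γ (X (γ t)) t)
    (hγΩ : ∀ t ∈ Ico a b, γ t ∈ Ω) : γ b ∉ frontier Ω := by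
  intro hb
  obtain ⟨hopen, hgraph⟩ := hΩ
  obtain ⟨e, h, ⟨L, hL⟩, hbelow⟩ := hgraph _ hb
  have hb0 := (mem_frontier_iff_graphHeight_eq_zero hopen hL.continuous hbelow).1 hb
  obtain ⟨he, hev⟩ := isLocallyBelowGraph_iff.1 hbelow
  obtain ⟨L', hF⟩ := exists_lipschitzWith_graphHeight e hL
  set F := graphHeight e h with hFdef
  have hFc := hF.continuous
  have hproj : Continuous fun y => y + (-F y) • e := by fun_prop
  have hev2 : ∀ᶠ y in 𝓝 (γ b), (∀ᶠ z in 𝓝 y, (z ∈ Ω ↔ F z < 0)) ∧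
      ∀ᶠ z in 𝓝 (y + (-F y) • e), (z ∈ Ω ↔ F z < 0) := by
    refine hev.eventually_nhds.and ?_
    have := hproj.tendsto (γ b)
    rw [hb0, neg_zero, zero_smul, add_zero] at this
    exact this.eventually hev.eventually_nhds
  obtain ⟨D, hD, hDopen, hbD⟩ := eventually_nhds_iff.1 hev2
  -- The point `y₀` is the vertical projection of `y` to the graph. There `F` has the same
  -- derivative as at `y`, nonzero because it is `1` on `e`, so a normal exists at `y₀` and `hout`
  -- applies. Passing from `X y₀` back to `X y` costs `L' * M * |F y|`.
  have hdF : ∀ y ∈ D, DifferentiableAt ℝ F y → fderiv ℝ F y (X y) ≤ L' * M * |F y| := by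
    intro y hy hdiff
    set y₀ := y + (-F y) • e with hy₀
    have hF0 : F y₀ = 0 := by
      rw [hy₀, hFdef, graphHeight_add_smul he]
      ring
    have hbelow₀ : IsLocallyBelowGraph Ω y₀ e h := isLocallyBelowGraph_iff.2 ⟨he, (hD y hy).2⟩
    have hfr : y₀ ∈ frontier Ω :=
      (mem_frontier_iff_graphHeight_eq_zero hopen hL.continuous hbelow₀).2 hF0
    have hfun : F = fun w => F (w + F y • e) - F y := by
      funext w
      rw [hFdef, graphHeight_add_smul he]
      ring
    have hyy : y₀ + F y • e = y := by
      rw [hy₀, neg_smul]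
      abel
    have hgrad : HasFDerivAt F (fderiv ℝ F y) y₀ := by
      have h1 : HasFDerivAt F (fderiv ℝ F y) (y₀ + F y • e) := by
        rw [hyy]
        exact hdiff.hasFDerivAt
      have h2 : HasFDerivAt (fun w => F (w + F y • e) - F y) (fderiv ℝ F y) y₀ :=
        (HasFDerivAt.comp (f := fun w => w + F y • e) y₀ h1
          ((hasFDerivAt_id y₀).add_const (F y • e))).sub_const (F y)
      exact h2.congr_of_eventuallyEq (Eventually.of_forall fun w => congrFun hfun w)
    have hline : fderiv ℝ F y e = 1 := by
      have h1 : HasDerivAt (fun t : ℝ => F (y + t • e)) (fderiv ℝ F y e) 0 := by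
        have h2 : HasFDerivAt F (fderiv ℝ F y) (y + (0 : ℝ) • e) := by
          simpa using hdiff.hasFDerivAt
        have h3 : HasDerivAt (fun t : ℝ => y + t • e) e 0 := by
          simpa using ((hasDerivAt_id (0 : ℝ)).smul_const e).const_add y
        exact h2.comp_hasDerivAt 0 h3
      have h2 : HasDerivAt (fun t : ℝ => F (y + t • e)) 1 0 := by
        simp only [hFdef, graphHeight_add_smul he]
        exact (hasDerivAt_id (0 : ℝ)).const_add _
      exact h1.unique h2
    set v := (InnerProductSpace.toDual ℝ 𝔼).symm (fderiv ℝ F y) with hv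
    have hvinner : ∀ w, inner ℝ v w = fderiv ℝ F y w := fun w =>
      InnerProductSpace.toDual_symm_apply
    have hv0 : v ≠ 0 := by
      intro h0
      have := hvinner e
      rw [hline, h0, inner_zero_left] at this
      exact zero_ne_one this
    have hnormal := isOutwardUnitNormal_of_hasGradientAt hfr hF0
      (hasFDerivAt_iff_hasGradientAt.1 hgrad) hv0 (hD y hy).2
    have h1 := hout y₀ hfr _ hnormal
    rw [inner_smul_right, real_inner_comm, hvinner] at h1
    have h2 : fderiv ℝ F y (X y₀) ≤ 0 :=
      nonpos_of_mul_nonpos_right h1 (inv_pos.2 (norm_pos_iff.2 hv0))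
    have h3 : fderiv ℝ F y (X y - X y₀) ≤ L' * (M * |F y|) := by
      refine (le_abs_self _).trans (((fderiv ℝ F y).le_opNorm _).trans ?_)
      refine mul_le_mul (norm_fderiv_le_of_lipschitz ℝ hF) ?_ (norm_nonneg _) L'.2
      refine (hX.norm_sub_le _ _).trans (le_of_eq ?_)
      rw [hy₀, sub_add_cancel_left, norm_neg, norm_smul, he, mul_one, norm_neg, Real.norm_eq_abs]
    rw [map_sub] at h3
    linarith
  have hcont : ContinuousWithinAt γ (Iic b) b :=
    (hγ b (right_mem_Icc.2 hab.le)).continuousAt.continuousWithinAt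
  obtain ⟨c, hcb, hc⟩ := (mem_nhdsLE_iff_exists_Ioc_subset).1
    (hcont.preimage_mem_nhdsWithin (hDopen.mem_nhds hbD))
  -- A time before `b` after which the curve stays in `D`, where the graph describes `Ω`.
  set a' := max a ((max a c + b) / 2) with ha'
  have hcb' : c < b := hcb
  have hmax : max a c < b := max_lt hab hcb'
  have ha1 : a ≤ a' := le_max_left _ _
  have ha2 : a' < b := max_lt hab (by linarith)
  have ha3 : c < a' := lt_max_of_lt_right (by linarith [le_max_right a c])
  have hin : ∀ t ∈ Icc a' b, γ t ∈ D := fun t ht => hc ⟨ha3.trans_le ht.1, ht.2⟩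
  have hneg := hF.neg_along_curve hX.continuous hDopen hdF ha2.le
    (fun t ht => hγ t ⟨ha1.trans ht.1, ht.2⟩) hin
    ((hD _ (hin a' (left_mem_Icc.2 ha2.le))).1.self_of_nhds.1 (hγΩ a' ⟨ha1, ha2⟩))
  exact hneg.ne hb0

end GraphDomains

/-! ### Characteristics and integration along them. -/

section Characteristics

/-- A function with vanishing derivative on `[a, b]` is constant there. -/
theorem eq_left_of_hasDerivAt_zero {E : Type*} [NormedAddCommGroup E] [NormedSpace ℝ E]
    {f : ℝ → E} {a b : ℝ} (hf : ContinuousOn f (Icc a b)) (h : ∀ t ∈ Ico a b, HasDerivAt f 0 t) :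
    ∀ t ∈ Icc a b, f t = f a :=
  constant_of_has_deriv_right_zero hf fun t ht => (h t ht).hasDerivWithinAt

variable {d : ℕ}

local notation "𝔼" => EuclideanSpace ℝ (Fin d)

/-- The characteristics issued from the points of `Ω \ closure U`, run backwards in a time
measured by `Ψ`, stay in `Ω \ closure U` until they reach the boundary of `U`. -/
theorem characteristic_mem {U Ω : Set 𝔼} (hU : IsOpen U) (hΩ : IsLipschitzDomain Ω)
    {Ψ : 𝔼 → ℝ} (hΨ : Differentiable ℝ Ψ)
    (hΨ0 : ∀ x ∈ frontier U, Ψ x = 0) (hΨpos : ∀ x ∈ Ω \ closure U, 0 < Ψ x)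
    {X : 𝔼 → 𝔼} {M : NNReal} (hX : LipschitzWith M X)
    (hΨX : ∀ x ∈ closure (Ω \ closure U), fderiv ℝ Ψ x (X x) = 1)
    (hout : ∀ x ∈ frontier Ω, ∀ ν, IsOutwardUnitNormal Ω x ν → 0 ≤ inner ℝ (X x) ν)
    {γ : ℝ → 𝔼} (h0 : γ 0 ∈ Ω \ closure U) (hγ : IsUnitCurve (fun y => -Ψ (γ 0) • X y) γ) :
    (∀ t ∈ Ico (0 : ℝ) 1, γ t ∈ Ω \ closure U ∧ Ψ (γ t) = Ψ (γ 0) * (1 - t)) ∧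
      γ 1 ∈ frontier U := by
  set ω := Ω \ closure U with hω
  have hωo : IsOpen ω := hΩ.1.sdiff isClosed_closure
  set T := Ψ (γ 0) with hT
  have hTpos : 0 < T := hΨpos _ h0
  have hXT : LipschitzWith (‖-T‖₊ * M) fun y => -T • X y :=
    (lipschitzWith_smul (-T)).comp hX
  have houtT : ∀ x ∈ frontier Ω, ∀ ν, IsOutwardUnitNormal Ω x ν →
      inner ℝ (-T • X x) ν ≤ 0 := by
    intro x hx ν hν
    rw [inner_smul_left, RCLike.conj_to_real]
    exact mul_nonpos_of_nonpos_of_nonneg (neg_nonpos.2 hTpos.le) (hout x hx ν hν)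
  -- At the end of a time interval spent in `ω`, the curve is in `closure ω`, hence outside the open
  -- set `U`, and it cannot be on `∂Ω`; only `ω` and `∂U` remain.
  have key : ∀ b ∈ Ioc (0 : ℝ) 1, (∀ t ∈ Ico 0 b, γ t ∈ ω) →
      Ψ (γ b) = T * (1 - b) ∧ (γ b ∈ ω ∨ γ b ∈ frontier U) := by
    intro b hb hbω
    have hcl : γ b ∈ closure ω := by
      have hlim : Tendsto γ (𝓝[<] b) (𝓝 (γ b)) :=
        (hγ b ⟨hb.1.le, hb.2⟩).continuousAt.tendsto.mono_left nhdsWithin_le_nhds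
      refine mem_closure_of_tendsto hlim ?_
      filter_upwards [Ioo_mem_nhdsLT hb.1] with t ht using hbω t ⟨ht.1.le, ht.2⟩
    have hd : ∀ t ∈ Icc 0 b, HasDerivAt (fun t => Ψ (γ t) + T * t) 0 t := by
      intro t ht
      have hmem : γ t ∈ closure ω := by
        rcases ht.2.eq_or_lt with h | h
        · rwa [h]
        · exact subset_closure (hbω t ⟨ht.1, h⟩)
      have h1 := (hΨ (γ t)).hasFDerivAt.comp_hasDerivAt t (hγ t ⟨ht.1, ht.2.trans hb.2⟩)
      rw [map_smul, hΨX _ hmem] at h1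
      exact (h1.add ((hasDerivAt_id t).const_mul T)).congr_deriv (by simp)
    have hΨb := eq_left_of_hasDerivAt_zero
      (fun t ht => (hd t ht).continuousAt.continuousWithinAt)
      (fun t ht => hd t (Ico_subset_Icc_self ht)) b (right_mem_Icc.2 hb.1.le)
    refine ⟨by rw [mul_zero, add_zero] at hΨb; linarith, ?_⟩
    have hnf := hΩ.notMem_frontier_of_curve hXT houtT hb.1
      (fun t ht => hγ t ⟨ht.1, ht.2.trans hb.2⟩) (fun t ht => (hbω t ht).1)
    have hbΩ : γ b ∈ Ω := by
      by_contra hn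
      rw [hΩ.1.frontier_eq] at hnf
      exact hnf ⟨closure_mono sdiff_subset hcl, hn⟩
    by_cases hbU : γ b ∈ closure U
    · right
      rw [hU.frontier_eq]
      refine ⟨hbU, fun hn => ?_⟩
      obtain ⟨y, hyU, hyω⟩ := mem_closure_iff.1 hcl U hU hn
      exact hyω.2 (subset_closure hyU)
    · exact Or.inl ⟨hbΩ, hbU⟩
  have hmem : ∀ t ∈ Ico (0 : ℝ) 1, γ t ∈ ω := by
    intro s hs
    by_contra hsω
    have hcpt : IsCompact (Icc 0 s ∩ γ ⁻¹' ωᶜ) := by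
      refine isCompact_Icc.of_isClosed_subset ?_ inter_subset_left
      exact (hγ.continuousOn.mono (Icc_subset_Icc_right hs.2.le)).preimage_isClosed_of_isClosed
        isClosed_Icc hωo.isClosed_compl
    -- At a first exit time `b < 1` the curve would be on `∂U`, where `Ψ = 0`, while `Ψ (γ b) = T *
    -- (1 - b) > 0`.
    obtain ⟨b, hb, hleast⟩ := hcpt.exists_isLeast ⟨s, right_mem_Icc.2 hs.1, hsω⟩
    have hb0 : 0 < b := by
      refine hb.1.1.lt_of_ne fun h => hb.2 ?_
      rwa [← h]
    have hb1 : b < 1 := hb.1.2.trans_lt hs.2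
    have hbω : ∀ t ∈ Ico 0 b, γ t ∈ ω := by
      intro t ht
      by_contra hn
      exact ht.2.not_ge (hleast ⟨⟨ht.1, ht.2.le.trans hb.1.2⟩, hn⟩)
    obtain ⟨h1, h2 | h2⟩ := key b ⟨hb0, hb1.le⟩ hbω
    · exact hb.2 h2
    · rw [hΨ0 _ h2] at h1
      nlinarith
  refine ⟨fun t ht => ⟨hmem t ht, ?_⟩, ?_⟩
  · rcases ht.1.eq_or_lt with h | h
    · rw [← h, sub_zero, mul_one]
    · exact (key t ⟨h, ht.2.le⟩ fun s hs => hmem s ⟨hs.1, hs.2.trans ht.2⟩).1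
  · obtain ⟨h1, h2 | h2⟩ := key 1 ⟨one_pos, le_rfl⟩ hmem
    · rw [sub_self, mul_zero] at h1
      exact absurd h1 (hΨpos _ h2).ne'
    · exact h2

/-- A differentiable function whose derivative along the characteristics vanishes is determined by
its values at their end points. -/
theorem eq_zero_of_fderiv_characteristic_eq_zero {ω Γ : Set 𝔼} {X : 𝔼 → 𝔼} {Ψ D : 𝔼 → ℝ}
    {γ : ℝ → 𝔼} (hγ : IsUnitCurve (fun y => -Ψ (γ 0) • X y) γ)
    (hγω : ∀ t ∈ Ico (0 : ℝ) 1, γ t ∈ ω) (hγΓ : γ 1 ∈ Γ) (hD : Differentiable ℝ D)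
    (hDX : ∀ x ∈ ω, fderiv ℝ D x (X x) = 0) (hDΓ : ∀ x ∈ Γ, D x = 0) : D (γ 0) = 0 := by
  refine Eq.trans ?_ (hDΓ _ hγΓ)
  refine (eq_left_of_hasDerivAt_zero (f := D ∘ γ)
    (hD.continuous.comp_continuousOn hγ.continuousOn) (fun t ht => ?_) 1
    (right_mem_Icc.2 zero_le_one)).symm
  have h1 := (hD (γ t)).hasFDerivAt.comp_hasDerivAt t (hγ t (Ico_subset_Icc_self ht))
  rwa [map_smul, hDX _ (hγω t ht), smul_zero] at h1

/-- Solution of `∇W · X = c` by integration along the characteristics. -/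
theorem exists_contDiff_solution {k : ℕ} (hk : 1 ≤ k) {ω : Set 𝔼} {X : 𝔼 → 𝔼} {c Ψ V : 𝔼 → ℝ}
    (hX : ContDiff ℝ k X) (hXs : HasCompactSupport X) (hc : ContDiff ℝ k c)
    (hcs : HasCompactSupport c) (hΨ : ContDiff ℝ k Ψ) (hV : ContDiff ℝ k V)
    (hΨpos : ∀ x ∈ ω, 0 < Ψ x) {R : ℝ} (hR : 0 < R) (hΨR : ∀ x ∈ ω, Ψ x ≤ R)
    (hchar : ∀ γ : ℝ → 𝔼, γ 0 ∈ ω → IsUnitCurve (fun y => -Ψ (γ 0) • X y) γ →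
      ∀ t ∈ Ico (0 : ℝ) 1, γ t ∈ ω ∧ Ψ (γ t) = Ψ (γ 0) * (1 - t)) :
    ∃ W : 𝔼 → ℝ, ContDiff ℝ k W ∧ (∀ x, Ψ x = 0 → W x = V x) ∧
      ∀ x ∈ ω, fderiv ℝ W x (X x) = c x := by
  have hk0 : (k : WithTop ℕ∞) ≠ 0 := by
    have : k ≠ 0 := by omega
    exact_mod_cast this
  -- The travel time is cut off outside the relevant range `[0, R]`, so that the extended field has
  -- compact support and is globally bounded and Lipschitz.
  let bump : ContDiffBump (0 : ℝ) := ⟨R, R + 1, hR, by linarith⟩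
  set τ : ℝ → ℝ := fun T => bump T * T with hτ
  have hτc : ContDiff ℝ k τ := bump.contDiff.mul contDiff_id
  have hτeq : ∀ T, 0 ≤ T → T ≤ R → τ T = T := by
    intro T h0 h1
    rw [hτ]
    simp only
    rw [bump.one_of_mem_closedBall (by simpa [abs_of_nonneg h0] using h1), one_mul]
  -- The full state is position, accumulated integral of `c`, and travel time. The travel time is a
  -- constant component, so that it enters as an initial value. The velocity does not depend on the
  -- accumulated integral, which is therefore left out of the domain of `Z₀`: as a function of the
  -- full state it would not have compact support.
  set Z₀ : 𝔼 × ℝ → 𝔼 × ℝ × ℝ := fun w => (-τ w.2 • X w.1, τ w.2 * c w.1, 0) with hZ₀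
  have hZ₀c : ContDiff ℝ k Z₀ := by
    refine ContDiff.prodMk ?_ (ContDiff.prodMk ?_ contDiff_const)
    · exact (hτc.comp contDiff_snd).neg.smul (hX.comp contDiff_fst)
    · exact (hτc.comp contDiff_snd).mul (hc.comp contDiff_fst)
  have hZ₀s : HasCompactSupport Z₀ := by
    refine HasCompactSupport.intro
      ((hXs.union hcs).prod (isCompact_closedBall (0 : ℝ) (R + 1))) fun w hw => ?_
    rw [mem_prod, not_and_or] at hw
    rcases hw with hw | hw
    · rw [mem_union, not_or] at hw
      simp [hZ₀, image_eq_zero_of_notMem_tsupport hw.1, image_eq_zero_of_notMem_tsupport hw.2]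
    · have : τ w.2 = 0 := by
        rw [hτ]
        simp only
        rw [bump.zero_of_le_dist (not_le.1 fun h => hw (Metric.mem_closedBall.2 h)).le, zero_mul]
      simp [hZ₀, this]
  obtain ⟨K, hK⟩ := ContDiff.lipschitzWith_of_hasCompactSupport hZ₀s hZ₀c hk0
  obtain ⟨C, hC⟩ := hZ₀s.exists_bound_of_continuous hZ₀c.continuous
  set Z : 𝔼 × ℝ × ℝ → 𝔼 × ℝ × ℝ := fun z => Z₀ (z.1, z.2.2) with hZ
  have hZc : ContDiff ℝ k Z :=
    hZ₀c.comp (contDiff_fst.prodMk (contDiff_snd.comp contDiff_snd))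
  obtain ⟨K', hZL⟩ : ∃ K', LipschitzWith K' Z :=
    ⟨_, hK.comp (LipschitzWith.prod_fst.prodMk (LipschitzWith.prod_snd.comp
      LipschitzWith.prod_snd))⟩
  have hZC : ∀ z, ‖Z z‖ ≤ C.toNNReal := fun z => (hC _).trans (Real.le_coe_toNNReal C)
  choose γ h0 hγ using fun z => exists_isUnitCurve hZL hZC z
  have hΦ : ContDiff ℝ k fun z => γ z 1 :=
    IsTimeOneMap.contDiff hk hZc hZL fun z => ⟨γ z, h0 z, rfl, hγ z⟩
  have hunique : ∀ η, IsUnitCurve Z η → γ (η 0) 1 = η 1 := fun η hη =>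
    IsUnitCurve.eqOn hZL (hγ _) hη (h0 _) (right_mem_Icc.2 zero_le_one)
  have hinit : ContDiff ℝ k fun x : 𝔼 => ((x, 0, Ψ x) : 𝔼 × ℝ × ℝ) :=
    contDiff_id.prodMk (contDiff_const.prodMk hΨ)
  set W : 𝔼 → ℝ := fun x => V (γ (x, 0, Ψ x) 1).1 + (γ (x, 0, Ψ x) 1).2.1 with hW
  have hWc : ContDiff ℝ k W :=
    (hV.comp (contDiff_fst.comp (hΦ.comp hinit))).add
      (contDiff_fst.comp (contDiff_snd.comp (hΦ.comp hinit)))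
  refine ⟨W, hWc, fun x hx => ?_, fun x hx => ?_⟩
  · have h1 : IsUnitCurve Z fun _ => (x, 0, 0) := by
      intro t _
      have h2 : Z (x, 0, 0) = 0 := by simp [hZ, hZ₀, hτ]
      simp only [h2]
      exact hasDerivAt_const _ _
    have h2 := hunique _ h1
    simp [hW, hx, h2]
  · set T := Ψ x with hT
    have hTpos : 0 < T := hΨpos x hx
    set η := γ (x, 0, T) with hη
    have hη0 : η 0 = (x, 0, T) := h0 _
    have hηT : ∀ t ∈ Icc (0 : ℝ) 1, (η t).2.2 = T := by
      intro t ht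
      have h1 : ∀ t ∈ Icc (0 : ℝ) 1, HasDerivAt (fun t => (η t).2.2) 0 t := fun t ht =>
        (HasFDerivAt.comp_hasDerivAt (f := fun t => (η t).2) t hasFDerivAt_snd
          (HasFDerivAt.comp_hasDerivAt (f := η) t hasFDerivAt_snd (hγ _ t ht)))
      have h2 := eq_left_of_hasDerivAt_zero
        (fun t ht => (h1 t ht).continuousAt.continuousWithinAt)
        (fun t ht => h1 t (Ico_subset_Icc_self ht)) t ht
      rw [h2, hη0]
    have hτT : ∀ t ∈ Icc (0 : ℝ) 1, τ (η t).2.2 = T := fun t ht => by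
      rw [hηT t ht, hτeq T hTpos.le (hΨR x hx)]
    set y : ℝ → 𝔼 := fun t => (η t).1 with hy
    set q : ℝ → ℝ := fun t => (η t).2.1 with hq
    have hy0 : y 0 = x := by simp [hy, hη0]
    have hq0 : q 0 = 0 := by simp [hq, hη0]
    have hyd : ∀ t ∈ Icc (0 : ℝ) 1, HasDerivAt y (-T • X (y t)) t := by
      intro t ht
      have h1 := HasFDerivAt.comp_hasDerivAt (f := η) t hasFDerivAt_fst (hγ (x, 0, T) t ht)
      refine h1.congr_deriv ?_
      simp only [hZ, hZ₀, ContinuousLinearMap.coe_fst', ← hη, hτT t ht, hy]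
    have hqd : ∀ t ∈ Icc (0 : ℝ) 1, HasDerivAt q (T * c (y t)) t := by
      intro t ht
      have h1 := HasFDerivAt.comp_hasDerivAt (f := fun t => (η t).2) t hasFDerivAt_fst
        (HasFDerivAt.comp_hasDerivAt (f := η) t hasFDerivAt_snd (hγ (x, 0, T) t ht))
      refine h1.congr_deriv ?_
      simp only [hZ, hZ₀, ContinuousLinearMap.coe_fst', ContinuousLinearMap.coe_snd', ← hη,
        hτT t ht, hy]
    have hyω := hchar y (by rwa [hy0]) (by rw [hy0]; exact hyd)
    rw [hy0] at hyω
    -- The rest of the curve after time `t`, rescaled to unit time, is the characteristic from `y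
    -- t`, because its travel time `T * (1 - t)` is `Ψ (y t)`. Differentiating this identity at `t =
    -- 0` from the right gives the equation at `x`.
    have hconst : ∀ t ∈ Ico (0 : ℝ) 1, W (y t) + q t = W x := by
      intro t ht
      have hts : ∀ s ∈ Icc (0 : ℝ) 1, t + (1 - t) * s ∈ Icc (0 : ℝ) 1 := fun s hs =>
        ⟨by nlinarith [ht.1, ht.2, hs.1], by nlinarith [ht.1, ht.2, hs.2]⟩
      have hd : ∀ s, HasDerivAt (fun s => t + (1 - t) * s) (1 - t) s := fun s => by
        simpa using ((hasDerivAt_id s).const_mul (1 - t)).const_add t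
      have hτt : τ (T * (1 - t)) = T * (1 - t) := by
        refine hτeq _ (mul_nonneg hTpos.le (sub_nonneg.2 ht.2.le)) ?_
        have := hΨR x hx
        nlinarith [ht.1]
      have hcurve : IsUnitCurve Z fun s =>
          (y (t + (1 - t) * s), q (t + (1 - t) * s) - q t, T * (1 - t)) := by
        intro s hs
        refine (((hyd _ (hts s hs)).scomp s (hd s)).prodMk
          ((((hqd _ (hts s hs)).comp s (hd s)).sub_const (q t)).prodMk
            (hasDerivAt_const s (T * (1 - t))))).congr_deriv ?_
        simp only [hZ, hZ₀, hτt, smul_smul]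
        refine Prod.ext ?_ (Prod.ext ?_ rfl)
        · simp only
          congr 1
          ring
        · simp only
          ring
      have h1 := hunique _ hcurve
      simp only [mul_zero, add_zero, sub_self, mul_one, add_sub_cancel] at h1
      have h2 : W (y t) = V (y 1) + (q 1 - q t) := by
        simp only [hW]
        rw [(hyω t ht).2, h1]
      rw [h2, hW]
      simp only [← hT, ← hη, hy, hq]
      ring
    have hdW : HasDerivAt (fun t => W (y t) + q t) (fderiv ℝ W x (-T • X x) + T * c x) 0 := by
      have h1 := ((hWc.differentiable hk0) (y 0)).hasFDerivAt.comp_hasDerivAt 0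
        (hyd 0 (left_mem_Icc.2 zero_le_one))
      have h2 := h1.add (hqd 0 (left_mem_Icc.2 zero_le_one))
      rwa [hy0] at h2
    have hzero : HasDerivWithinAt (fun t => W (y t) + q t) 0 (Ici 0) 0 := by
      refine (hasDerivWithinAt_const (0 : ℝ) (Ici 0) (W x)).congr_of_eventuallyEq ?_
        (hconst 0 (left_mem_Ico.2 one_pos))
      filter_upwards [Ico_mem_nhdsGE one_pos] with t ht using hconst t ht
    have heq := (uniqueDiffWithinAt_Ici (0 : ℝ)).eq_deriv _ hdW.hasDerivWithinAt hzero
    rw [map_smul, smul_eq_mul] at heq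
    have : T * (c x - fderiv ℝ W x (X x)) = 0 := by linarith
    linarith [(mul_eq_zero.1 this).resolve_left hTpos.ne']

end Characteristics

/-! ### Normalization of the field, integrating factor, and uniqueness. -/

section Main

/-- A `C^k` function without zeros on a compact set has a compactly supported `C^k` inverse there. -/
theorem exists_contDiff_inv_on_compact {E : Type*} [NormedAddCommGroup E] [NormedSpace ℝ E]
    [FiniteDimensional ℝ E] {k : ℕ} {K : Set E} (hK : IsCompact K) {u : E → ℝ}
    (hu : ContDiff ℝ k u) (hu0 : ∀ x ∈ K, u x ≠ 0) :
    ∃ κ : E → ℝ, ContDiff ℝ k κ ∧ HasCompactSupport κ ∧ ∀ x ∈ K, κ x = (u x)⁻¹ := by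
  obtain ⟨K', hK', hKK', hK'S⟩ := exists_compact_between hK
    (isOpen_ne_fun hu.continuous continuous_const) hu0
  obtain ⟨χ, h1, h0, -⟩ := exists_contMDiffMap_one_nhds_of_subset_interior (n := (k : ℕ∞))
    (modelWithCornersSelf ℝ E) hK.isClosed hKK'
  have hχ : ContDiff ℝ k χ := χ.contMDiff.contDiff
  refine ⟨fun x => χ x * (u x)⁻¹, ?_, ?_, ?_⟩
  · refine contDiff_iff_contDiffAt.2 fun x => ?_
    by_cases hx : u x = 0
    · have hx' : K'ᶜ ∈ 𝓝 x := hK'.isClosed.isOpen_compl.mem_nhds fun h => hK'S h hx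
      refine (contDiffAt_const (c := (0 : ℝ))).congr_of_eventuallyEq ?_
      filter_upwards [hx'] with y hy
      rw [h0 y hy, zero_mul]
    · exact hχ.contDiffAt.mul (hu.contDiffAt.inv hx)
  · exact HasCompactSupport.intro hK' fun x hx => by rw [h0 x hx, zero_mul]
  · intro x hx
    simp only [h1.self_of_nhdsSet x hx, one_mul]

theorem contDiff_gradient {E : Type*} [NormedAddCommGroup E] [InnerProductSpace ℝ E]
    [CompleteSpace E] {k : ℕ} {f : E → ℝ} (hf : ContDiff ℝ (k + 1 : ℕ) f) :
    ContDiff ℝ k (gradient f) := by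
  have h : ContDiff ℝ k (fderiv ℝ f) := hf.fderiv_right (by norm_cast)
  exact (InnerProductSpace.toDual ℝ E).symm.contDiff.comp h

end Main

theorem mainTheorem4 {d k : ℕ} (hk : 1 ≤ k)
    (U Ω ω : Set (EuclideanSpace ℝ (Fin d)))
    (hU : IsClassDomain k U) (hUb : Bornology.IsBounded U)
    (hΩ : IsLipschitzDomain Ω) (hΩb : Bornology.IsBounded Ω)
    (hUΩ : closure U ⊆ Ω) (hω : ω = Ω \ closure U)
    (ψ : EuclideanSpace ℝ (Fin d) → ℝ) (hψ : IsOfClassOn (k + 1) ψ (closure ω))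
    (hψ_zero : ∀ x ∈ frontier U, ψ x = 0) (hψ_pos : ∀ x ∈ ω, 0 < ψ x)
    (n : EuclideanSpace ℝ (Fin d) → EuclideanSpace ℝ (Fin d))
    (hn_cont : ContinuousOn n (closure ω)) (hn : ∀ x ∈ ω, n x = gradient ψ x)
    (lam : ℝ) (hlam : 0 < lam) (hψ_grad : ∀ x ∈ ω, lam ≤ ‖gradient ψ x‖)
    (hn_out : ∀ x ∈ frontier Ω, ∀ ν : EuclideanSpace ℝ (Fin d),
      IsOutwardUnitNormal Ω x ν → 0 < inner ℝ (n x) ν)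
    (β g V : EuclideanSpace ℝ (Fin d) → ℝ)
    (hβ : IsOfClassOn k β (closure ω)) (hg : IsOfClassOn k g (closure ω))
    (hV : IsOfClassOn k V (frontier U)) :
    ∃ W : EuclideanSpace ℝ (Fin d) → ℝ,
      IsTransportSolution ω (frontier U) n β g V W ∧
      (∀ W' : EuclideanSpace ℝ (Fin d) → ℝ,
        IsTransportSolution ω (frontier U) n β g V W' → EqOn W' W (closure ω)) ∧
      IsOfClassOn k W (closure ω) := by
  obtain ⟨Ψ, hΨc, hΨeq⟩ := hψ
  obtain ⟨βe, hβc, hβeq⟩ := hβ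
  obtain ⟨ge, hgc, hgeq⟩ := hg
  obtain ⟨Ve, hVc, hVeq⟩ := hV
  have hk0 : (k : WithTop ℕ∞) ≠ 0 := by
    have : k ≠ 0 := by omega
    exact_mod_cast this
  have hk1 : ((1 : ℕ) : WithTop ℕ∞) ≤ k := by exact_mod_cast hk
  have hωo : IsOpen ω := hω ▸ hΩ.1.sdiff isClosed_closure
  have hK : IsCompact (closure ω) := by
    refine (hΩb.subset ?_).isCompact_closure
    rw [hω]
    exact sdiff_subset
  have hsub : ω ⊆ closure ω := subset_closure
  -- Boundary points of `U` are limits of points outside `closure U`, which eventually lie in the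
  -- open set `Ω`. This lets the extensions be identified with the given data on `∂U`.
  have hfU : frontier U ⊆ closure ω := by
    intro x hx
    obtain ⟨e, h, hh, hbelow⟩ := hU.2 x hx
    have h1 := mem_closure_compl_closure_of_isLocallyBelowGraph hU.1 hh.continuous hbelow hx
    rw [hω]
    exact hΩ.1.inter_closure ⟨hUΩ (frontier_subset_closure hx), h1⟩
  have hfΩ : frontier Ω ⊆ closure ω := by
    intro x hx
    rw [hΩ.1.frontier_eq] at hx
    rw [hω]
    exact isClosed_closure.isOpen_compl.closure_inter ⟨hx.1, fun h => hx.2 (hUΩ h)⟩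

  have hΨc' : ContDiff ℝ (k + 1 : ℕ) Ψ := by exact_mod_cast hΨc
  have hΨk : ContDiff ℝ k Ψ := hΨc'.of_le (by norm_cast; omega)
  set N := gradient Ψ with hN
  have hNc : ContDiff ℝ k N := contDiff_gradient hΨc'
  have hgradω : ∀ (f₁ f₂ : EuclideanSpace ℝ (Fin d) → ℝ), EqOn f₁ f₂ (closure ω) →
      ∀ x ∈ ω, gradient f₁ x = gradient f₂ x := fun f₁ f₂ h x hx =>
    ((h.mono hsub).eventuallyEq_of_mem (hωo.mem_nhds hx)).gradient_eq
  have hψN : ∀ x ∈ ω, gradient ψ x = N x := fun x hx => (hgradω Ψ ψ hΨeq x hx).symm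
  have hnN : EqOn n N (closure ω) :=
    EqOn.of_subset_closure (fun x hx => (hn x hx).trans (hψN x hx)) hn_cont
      hNc.continuous.continuousOn hsub le_rfl
  have hNlam : ∀ x ∈ closure ω, lam ≤ ‖N x‖ := by
    refine fun x hx => closure_minimal (t := {x | lam ≤ ‖N x‖}) (fun y hy => ?_)
      (isClosed_le continuous_const hNc.continuous.norm) hx
    rw [mem_ofPred_eq, ← hψN y hy]
    exact hψ_grad y hy
  have hN0 : ∀ x ∈ closure ω, ‖N x‖ ^ 2 ≠ 0 := fun x hx =>
    pow_ne_zero _ (hlam.trans_le (hNlam x hx)).ne'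
  obtain ⟨κ, hκc, hκs, hκ⟩ := exists_contDiff_inv_on_compact hK (hNc.norm_sq ℝ) hN0
  have hκ0 : ∀ x ∈ closure ω, κ x ≠ 0 := fun x hx => by
    rw [hκ x hx]
    exact inv_ne_zero (hN0 x hx)
  -- With `κ = |N|⁻²` on `closure ω`, `Ψ` grows at unit rate along `X`; the compact support of `κ`
  -- makes `X` globally Lipschitz.
  set X := fun x => κ x • N x with hX
  have hXc : ContDiff ℝ k X := hκc.smul hNc
  have hXs : HasCompactSupport X := hκs.smul_right
  obtain ⟨M, hXL⟩ := ContDiff.lipschitzWith_of_hasCompactSupport hXs hXc hk0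
  have hΨX : ∀ x ∈ closure (Ω \ closure U), fderiv ℝ Ψ x (X x) = 1 := by
    rw [← hω]
    intro x hx
    rw [← inner_gradient_left, hX, inner_smul_right, real_inner_self_eq_norm_sq, hκ x hx]
    exact inv_mul_cancel₀ (hN0 x hx)
  have hout : ∀ x ∈ frontier Ω, ∀ ν, IsOutwardUnitNormal Ω x ν → 0 ≤ inner ℝ (X x) ν := by
    intro x hx ν hν
    rw [hX, inner_smul_left, RCLike.conj_to_real, ← hnN (hfΩ hx), hκ x (hfΩ hx)]
    exact mul_nonneg (by positivity) (hn_out x hx ν hν).le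
  have hΨ0 : ∀ x ∈ frontier U, Ψ x = 0 := fun x hx => (hΨeq (hfU hx)).trans (hψ_zero x hx)
  have hΨpos : ∀ x ∈ ω, 0 < Ψ x := fun x hx => by
    rw [hΨeq (hsub hx)]
    exact hψ_pos x hx
  have hchar : ∀ γ : ℝ → EuclideanSpace ℝ (Fin d), γ 0 ∈ ω →
      IsUnitCurve (fun y => -Ψ (γ 0) • X y) γ →
      (∀ t ∈ Ico (0 : ℝ) 1, γ t ∈ ω ∧ Ψ (γ t) = Ψ (γ 0) * (1 - t)) ∧ γ 1 ∈ frontier U := by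
    subst hω
    exact fun γ h0 hγ => characteristic_mem hU.1 hΩ (hΨk.differentiable hk0) hΨ0 hΨpos hXL hΨX
      hout h0 hγ
  obtain ⟨R, hR⟩ := hK.exists_bound_of_continuousOn hΨk.continuous.continuousOn
  have hΨR : ∀ x ∈ ω, Ψ x ≤ max R 1 := fun x hx =>
    (le_abs_self _).trans ((hR x (hsub hx)).trans (le_max_left _ _))
  have hsolve : ∀ c v : EuclideanSpace ℝ (Fin d) → ℝ, ContDiff ℝ k c → ContDiff ℝ k v →
      ∃ W : EuclideanSpace ℝ (Fin d) → ℝ, ContDiff ℝ k W ∧ (∀ x ∈ frontier U, W x = v x) ∧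
        ∀ x ∈ ω, fderiv ℝ W x (X x) = κ x * c x := by
    intro c v hc hv
    obtain ⟨W, h1, h2, h3⟩ := exists_contDiff_solution hk hXc hXs (hκc.mul hc) hκs.mul_right
      hΨk hv hΨpos (lt_max_of_lt_right one_pos) hΨR fun γ h0 hγ => (hchar γ h0 hγ).1
    exact ⟨W, h1, fun x hx => h2 x (hΨ0 x hx), h3⟩
  -- Here `exp A` is the integrating factor: multiplying a solution by it removes the zeroth-order
  -- term, leaving the equation for `Y`.
  obtain ⟨A, hAc, hA0, hA⟩ := hsolve βe (fun _ => 0) hβc contDiff_const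
  obtain ⟨Y, hYc, hY0, hY⟩ := hsolve (fun x => ge x * Real.exp (A x)) Ve (hgc.mul hAc.exp) hVc
  have hAd := hAc.differentiable hk0
  have hYd := hYc.differentiable hk0
  have hWc : ContDiff ℝ k fun x => Y x * Real.exp (-A x) := hYc.mul hAc.neg.exp
  have hpde : ∀ (f : EuclideanSpace ℝ (Fin d) → ℝ), ∀ x ∈ ω,
      inner ℝ (gradient f x) (n x) + β x * f x = g x ↔
        fderiv ℝ f x (X x) = κ x * (ge x - βe x * f x) := by
    intro f x hx
    have hκx := hκ0 x (hsub hx)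
    rw [hnN (hsub hx), ← hβeq (hsub hx), ← hgeq (hsub hx), inner_gradient_left, hX, map_smul,
      smul_eq_mul, mul_right_inj' hκx, eq_sub_iff_add_eq]
  have hWpde : ∀ x ∈ ω, fderiv ℝ (fun x => Y x * Real.exp (-A x)) x (X x) =
      κ x * (ge x - βe x * (Y x * Real.exp (-A x))) := by
    intro x hx
    have h1 := (hYd x).hasFDerivAt.mul (hAd x).hasFDerivAt.neg.exp
    have hexp : Real.exp (A x) * Real.exp (-A x) = 1 := by
      rw [← Real.exp_add, add_neg_cancel, Real.exp_zero]
    refine (congrArg (fun L => L (X x)) (HasFDerivAt.fderiv h1)).trans ?_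
    simp only [add_apply, smul_apply,
      neg_apply, smul_eq_mul, hA x hx, hY x hx]
    linear_combination (κ x * ge x) * hexp
  refine ⟨fun x => Y x * Real.exp (-A x),
    ⟨⟨_, hWc.of_le hk1, fun _ _ => rfl⟩, fun x hx => (hpde _ x hx).2 (hWpde x hx), ?_⟩, ?_,
    ⟨_, hWc, fun _ _ => rfl⟩⟩
  · intro x hx
    simp only [hY0 x hx, hA0 x hx, hVeq hx, neg_zero, Real.exp_zero, mul_one]
  rintro W' ⟨⟨F, hFc, hFeq⟩, hF, hFV⟩
  have hFd : Differentiable ℝ F := hFc.differentiable (by norm_num)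
  -- The competitor is replaced by its `C¹` extension `F`, which is differentiable also at the end
  -- point on `∂U`. The function `F * exp A - Y` has zero derivative along each characteristic and
  -- vanishes on `∂U`.
  have heq : EqOn F (fun x => Y x * Real.exp (-A x)) ω := by
    intro x hx
    have hbound := hXs.exists_bound_of_continuous hXc.continuous
    obtain ⟨C, hC⟩ := hbound
    obtain ⟨γ, h0, hγ⟩ := exists_isUnitCurve (C := ‖Ψ x‖₊ * C.toNNReal)
      ((lipschitzWith_smul (-Ψ x)).comp hXL) (fun y => by
        rw [Function.comp_apply, norm_smul, norm_neg, NNReal.coe_mul, coe_nnnorm]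
        exact mul_le_mul_of_nonneg_left ((hC y).trans (Real.le_coe_toNNReal C)) (norm_nonneg _)) x
    subst h0
    obtain ⟨h1, h2⟩ := hchar γ hx hγ
    have h3 := eq_zero_of_fderiv_characteristic_eq_zero
      (D := fun x => F x * Real.exp (A x) - Y x) hγ (fun t ht => (h1 t ht).1) h2
      ((hFd.mul hAd.exp).sub hYd) (fun y hy => ?_) (fun y hy => ?_)
    · simp only
      rw [← sub_eq_zero.1 h3, mul_assoc, ← Real.exp_add, add_neg_cancel, Real.exp_zero, mul_one]
    · have h4 : fderiv ℝ F y (X y) = κ y * (ge y - βe y * F y) := by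
        refine (hpde F y hy).1 ?_
        rw [hgradω F W' hFeq y hy, hFeq (hsub hy)]
        exact hF y hy
      have h5 := ((hFd y).hasFDerivAt.mul (hAd y).hasFDerivAt.exp).sub (hYd y).hasFDerivAt
      refine (congrArg (fun L => L (X y)) (HasFDerivAt.fderiv h5)).trans ?_
      simp only [add_apply, sub_apply,
        smul_apply, smul_eq_mul, hA y hy, hY y hy, h4]
      ring
    · simp only [hA0 y hy, hY0 y hy, Real.exp_zero, mul_one, hFeq (hfU hy), hFV y hy, hVeq hy,
        sub_self]
  have heq' : EqOn F (fun x => Y x * Real.exp (-A x)) (closure ω) :=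
    heq.of_subset_closure hFc.continuous.continuousOn hWc.continuous.continuousOn hsub le_rfl
  exact fun x hx => (hFeq hx).symm.trans (heq' hx)
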